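/- Let $M$ be a smooth $n$-dimensional manifold and let $F\colon M\to\mathbb{C}^{n+1}=\mathbb{R}^{2n+2}$ be a smooth immersion with values in the unit sphere $S^{2n+1}$; give $M$ the metric induced by $F$, let $J$ be the complex structure of $\mathbb{C}^{n+1}$ and let $N_pM$ be the orthogonal complement of $dF(T_pM)\oplus\mathbb{R}F(p)$ in $\mathbb{C}^{n+1}$, i.e. the normal space of $M$ in $S^{2n+1}$. Assume that $M$ is Legendrian, i.e. $J\,dF(T_pM)\subset N_pM$ and $JF(p)\in N_pM$ for all $p\in M$. Let $B$ be the second fundamental form of $M$ in $S^{2n+1}$, put $\sigma(X,Y,Z)=\langle B(X,Y),J\,dF(Z)\rangle$, and for an orthonormal basis $(e_1,\dots,e_n)$ of $T_pM$ let $$S_{ab}=\sum_{i,j=1}^n\sigma(e_i,e_j,e_a)\,\sigma(e_i,e_j,e_b)\qquad(1\le a,b\le n)$$ be the fundamental matrix at $p$. Orient the normal spaces $N_qM$, continuously for $q$ near $p$, and let $\gamma\colon M\to G(n+1,n+1)$, $\gamma(q)=N_qM$, be the Gauss map into the Grassmann manifold of oriented $(n+1)$-dimensional linear subspaces of $\mathbb{R}^{2n+2}$.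 If exactly $k$ of the eigenvalues of $(S_{ab})$, counted with multiplicity, are positive (the other $n-k$ being then $0$), then $\gamma$ is differentiable at $p$ and its differential $d\gamma_p$ has rank $k$. -/

import Mathlib

open Module
open scoped Manifold ContDiff Topology

noncomputable section

/-! ### The Grassmann manifold of oriented `k`-planes -/

/-- The set of oriented `k`-dimensional linear subspaces of a real vector space `E`. -/
structure OrientedGrassmannian (k : ℕ) (E : Type*) [AddCommGroup E] [Module ℝ E] where
  /-- the underlying linear subspace -/
  plane : Submodule ℝ E
  /-- its dimension is `k` -/
  finrank_plane : finrank ℝ plane = k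
  /-- its orientation -/
  orientation : Orientation ℝ plane (Fin k)

namespace OrientedGrassmannian

/-- The vector space `Hom(ℝ^k, ℝ^(d - k))`, `d = dim E`, on which the Grassmann manifold of oriented
`k`-planes in `E` is modelled. -/
abbrev Model (k : ℕ) (E : Type*) [AddCommGroup E] [Module ℝ E] : Type :=
  EuclideanSpace ℝ (Fin k) →L[ℝ] EuclideanSpace ℝ (Fin (finrank ℝ E - k))

/-- Linear identifications of `ℝ^k × ℝ^(d - k)` with `E`, `d = dim E`. -/
abbrev Splitting (k : ℕ) (E : Type*) [NormedAddCommGroup E] [NormedSpace ℝ E] : Type _ :=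
  (EuclideanSpace ℝ (Fin k) × EuclideanSpace ℝ (Fin (finrank ℝ E - k))) ≃L[ℝ] E

variable {k : ℕ} {E : Type*} [NormedAddCommGroup E] [NormedSpace ℝ E]

theorem mk_eq_mk_iff {V W : Submodule ℝ E} (hV : finrank ℝ V = k) (hW : finrank ℝ W = k)
    (o : Orientation ℝ V (Fin k)) (o' : Orientation ℝ W (Fin k)) :
    OrientedGrassmannian.mk V hV o = OrientedGrassmannian.mk W hW o' ↔
      ∃ h : V = W, Orientation.map (Fin k) (LinearEquiv.ofEq V W h) o = o' := by
  constructor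
  · intro h
    obtain ⟨rfl, h2⟩ := OrientedGrassmannian.mk.inj h
    have h3 := eq_of_heq h2
    subst h3
    refine ⟨rfl, ?_⟩
    rw [LinearEquiv.ofEq_rfl, Orientation.map_refl]
    rfl
  · rintro ⟨rfl, h'⟩
    rw [LinearEquiv.ofEq_rfl, Orientation.map_refl] at h'
    dsimp at h'
    rw [h']

/-- The image of an injective linear map `ℝ^k → E`, oriented by the image of the standard basis. -/
def ofInjective (L : EuclideanSpace ℝ (Fin k) →L[ℝ] E) (hL : Function.Injective L) :
    OrientedGrassmannian k E where
  plane := LinearMap.range (L : EuclideanSpace ℝ (Fin k) →ₗ[ℝ] E)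
  finrank_plane := by
    rw [LinearMap.finrank_range_of_inj (f := (L : EuclideanSpace ℝ (Fin k) →ₗ[ℝ] E)) hL]
    simp
  orientation := ((EuclideanSpace.basisFun (Fin k) ℝ).toBasis.map
    (LinearEquiv.ofInjective (L : EuclideanSpace ℝ (Fin k) →ₗ[ℝ] E) hL)).orientation

theorem ofInjective_eq_iff (L L' : EuclideanSpace ℝ (Fin k) →L[ℝ] E)
    (hL : Function.Injective L) (hL' : Function.Injective L') :
    ofInjective L hL = ofInjective L' hL' ↔
      ∃ g : EuclideanSpace ℝ (Fin k) →L[ℝ] EuclideanSpace ℝ (Fin k),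
        0 < LinearMap.det (g : EuclideanSpace ℝ (Fin k) →ₗ[ℝ] EuclideanSpace ℝ (Fin k)) ∧
        L = L'.comp g := by
  set e := LinearEquiv.ofInjective (L : EuclideanSpace ℝ (Fin k) →ₗ[ℝ] E) hL with he
  set e' := LinearEquiv.ofInjective (L' : EuclideanSpace ℝ (Fin k) →ₗ[ℝ] E) hL' with he'
  set b := (EuclideanSpace.basisFun (Fin k) ℝ).toBasis
  have key : ∀ h : LinearMap.range (L : EuclideanSpace ℝ (Fin k) →ₗ[ℝ] E)
        = LinearMap.range (L' : EuclideanSpace ℝ (Fin k) →ₗ[ℝ] E),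
      (Orientation.map (Fin k) (LinearEquiv.ofEq _ _ h) (b.map e).orientation
        = (b.map e').orientation ↔
      0 < LinearMap.det (((e.trans (LinearEquiv.ofEq _ _ h)).trans e'.symm :
        EuclideanSpace ℝ (Fin k) ≃ₗ[ℝ] EuclideanSpace ℝ (Fin k)) :
          EuclideanSpace ℝ (Fin k) →ₗ[ℝ] EuclideanSpace ℝ (Fin k))) := by
    intro h
    rw [← b.orientation_comp_linearEquiv_eq_iff_det_pos]
    rw [← Basis.orientation_map]
    have h1 : b.map ((e.trans (LinearEquiv.ofEq _ _ h)).trans e'.symm)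
        = ((b.map e).map (LinearEquiv.ofEq _ _ h)).map e'.symm := by
      ext i; rfl
    rw [h1, Basis.orientation_map _ e'.symm, Basis.orientation_map _ e']
    rw [← Orientation.map_symm, Equiv.symm_apply_eq]
  refine (mk_eq_mk_iff _ _ _ _).trans ?_
  constructor
  · rintro ⟨h, h'⟩
    rw [key h] at h'
    refine ⟨LinearMap.toContinuousLinearMap
      ((e.trans (LinearEquiv.ofEq _ _ h)).trans e'.symm).toLinearMap, by simpa using h', ?_⟩
    ext1 x
    have h2 : ((e' (e'.symm ((LinearEquiv.ofEq _ _ h) (e x)))) : E) = L x := by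
      rw [LinearEquiv.apply_symm_apply]; rfl
    exact h2.symm
  · rintro ⟨g, hg, rfl⟩
    have hsurj : Function.Surjective g := by
      have : IsUnit (LinearMap.det
          (g : EuclideanSpace ℝ (Fin k) →ₗ[ℝ] EuclideanSpace ℝ (Fin k))) := hg.ne'.isUnit
      exact (LinearMap.equivOfDetNeZero _ hg.ne').surjective
    have h : LinearMap.range ((L'.comp g : EuclideanSpace ℝ (Fin k) →L[ℝ] E) :
          EuclideanSpace ℝ (Fin k) →ₗ[ℝ] E)
        = LinearMap.range (L' : EuclideanSpace ℝ (Fin k) →ₗ[ℝ] E) := by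
      ext y
      constructor
      · rintro ⟨x, rfl⟩
        exact ⟨g x, rfl⟩
      · rintro ⟨x, rfl⟩
        obtain ⟨z, rfl⟩ := hsurj x
        exact ⟨z, rfl⟩
    refine ⟨h, (key h).2 ?_⟩
    convert hg using 2
    ext1 x
    apply hL'
    have h2 : ((e' (e'.symm ((LinearEquiv.ofEq _ _ h) (e x)))) : E) = L' (g x) := by
      rw [LinearEquiv.apply_symm_apply]; rfl
    exact h2

/-- The injection `x ↦ Φ (x, A x)` of `ℝ^k` onto the graph of `A`, where `Φ` is a linear
identification of `ℝ^k × ℝ^(d - k)` with `E`. -/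
def graphMap (Φ : Splitting k E)
    (A : Model k E) : EuclideanSpace ℝ (Fin k) →L[ℝ] E :=
  Φ.toContinuousLinearMap.comp ((ContinuousLinearMap.id ℝ _).prod A)

theorem graphMap_injective
    (Φ : Splitting k E)
    (A : Model k E) : Function.Injective (graphMap Φ A) := by
  intro x y h
  exact congrArg Prod.fst (Φ.injective h)

/-- The oriented graph of `A` with respect to the identification `Φ`. -/
def graph (Φ : Splitting k E)
    (A : Model k E) : OrientedGrassmannian k E :=
  ofInjective (graphMap Φ A) (graphMap_injective Φ A)

/-- The `ℝ^k`-block of `Ψ⁻¹ ∘ Φ` on the graph of `A`. -/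
def blockFst (Φ Ψ : Splitting k E)
    (A : Model k E) : EuclideanSpace ℝ (Fin k) →L[ℝ] EuclideanSpace ℝ (Fin k) :=
  (ContinuousLinearMap.fst ℝ _ _).comp (Ψ.symm.toContinuousLinearMap.comp (graphMap Φ A))

/-- The `ℝ^(d - k)`-block of `Ψ⁻¹ ∘ Φ` on the graph of `A`. -/
def blockSnd (Φ Ψ : Splitting k E)
    (A : Model k E) : Model k E :=
  (ContinuousLinearMap.snd ℝ _ _).comp (Ψ.symm.toContinuousLinearMap.comp (graphMap Φ A))

theorem graph_eq_graph_iff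
    (Φ Ψ : Splitting k E)
    (A B : Model k E) :
    graph Φ A = graph Ψ B ↔ 0 < (blockFst Φ Ψ A).det ∧ blockSnd Φ Ψ A = B.comp (blockFst Φ Ψ A) := by
  unfold graph
  rw [ofInjective_eq_iff]
  constructor
  · rintro ⟨g, hg, h⟩
    have h1 : blockFst Φ Ψ A = g := by
      ext1 x
      rw [blockFst, h]; simp [graphMap]
    have h2 : blockSnd Φ Ψ A = B.comp g := by
      ext1 x
      rw [blockSnd, h]; simp [graphMap]
    rw [h1, h2]
    exact ⟨hg, rfl⟩
  · rintro ⟨hg, h⟩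
    refine ⟨blockFst Φ Ψ A, hg, ?_⟩
    ext1 x
    apply Ψ.symm.injective
    have h' := DFunLike.congr_fun h x
    apply Prod.ext
    · simp [graphMap, blockFst]
    · simpa [graphMap, blockSnd] using h'

theorem graph_injective
    (Φ : Splitting k E) :
    Function.Injective (graph Φ) := by
  intro A B h
  have h := ((graph_eq_graph_iff Φ Φ A B).1 h).2
  have h1 : blockFst Φ Φ A = ContinuousLinearMap.id ℝ _ := by
    ext1 x; simp [blockFst, graphMap]
  have h2 : blockSnd Φ Φ A = A := by
    ext1 x; simp [blockSnd, graphMap]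
  rw [h1, h2] at h
  simpa using h

/-- The affine chart of the Grassmannian attached to `Φ`: it sends the oriented graph of `A` to `A`.
It is defined on the set of all such graphs. -/
def graphChart
    (Φ : Splitting k E) :
    PartialEquiv (OrientedGrassmannian k E) (Model k E) where
  toFun := Function.invFun (graph Φ)
  invFun := graph Φ
  source := Set.range (graph Φ)
  target := Set.univ
  map_source' _ _ := Set.mem_univ _
  map_target' A _ := ⟨A, rfl⟩
  left_inv' _ hV := Function.invFun_eq hV
  right_inv' A _ := Function.leftInverse_invFun (graph_injective Φ) A

theorem mem_graphChart_trans_source (Φ Ψ : Splitting k E) (A : Model k E) :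
    A ∈ ((graphChart Φ).symm.trans (graphChart Ψ)).source ↔ ∃ B, graph Ψ B = graph Φ A :=
  ⟨fun h => h.2, fun h => ⟨Set.mem_univ _, h⟩⟩

theorem isUnit_of_det_pos {g : EuclideanSpace ℝ (Fin k) →L[ℝ] EuclideanSpace ℝ (Fin k)}
    (hg : 0 < g.det) : IsUnit g := by
  let e := (LinearMap.equivOfDetNeZero
    (g : EuclideanSpace ℝ (Fin k) →ₗ[ℝ] EuclideanSpace ℝ (Fin k)) hg.ne').toContinuousLinearEquiv
  refine ⟨ContinuousLinearEquiv.toUnit e, ?_⟩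
  ext1 x
  rfl

theorem graphChart_trans_source
    (Φ Ψ : Splitting k E) :
    ((graphChart Φ).symm.trans (graphChart Ψ)).source = {A | 0 < (blockFst Φ Ψ A).det} := by
  ext A
  rw [mem_graphChart_trans_source]
  constructor
  · rintro ⟨B, hB⟩
    exact ((graph_eq_graph_iff Φ Ψ A B).1 hB.symm).1
  · intro h
    have h' : 0 < (blockFst Φ Ψ A).det := h
    have hu : IsUnit (blockFst Φ Ψ A) :=
      isUnit_of_det_pos h'
    refine ⟨(blockSnd Φ Ψ A).comp (Ring.inverse (blockFst Φ Ψ A)), Eq.symm ?_⟩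
    rw [graph_eq_graph_iff]
    refine ⟨h', ?_⟩
    have := Ring.inverse_mul_cancel _ hu
    rw [ContinuousLinearMap.comp_assoc]
    change _ = (blockSnd Φ Ψ A).comp (Ring.inverse (blockFst Φ Ψ A) * blockFst Φ Ψ A)
    rw [this]
    rfl

theorem graphChart_trans_apply
    (Φ Ψ : Splitting k E)
    (A : Model k E) (hA : 0 < (blockFst Φ Ψ A).det) :
    ((graphChart Φ).symm.trans (graphChart Ψ)) A
      = (blockSnd Φ Ψ A).comp (Ring.inverse (blockFst Φ Ψ A)) := by
  have hs : A ∈ ((graphChart Φ).symm.trans (graphChart Ψ)).source := by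
    rw [graphChart_trans_source]; exact hA
  have h1 : ∃ B, graph Ψ B = graph Φ A := (mem_graphChart_trans_source Φ Ψ A).1 hs
  have h2 : graph Ψ (((graphChart Φ).symm.trans (graphChart Ψ)) A) = graph Φ A :=
    Function.invFun_eq h1
  have h3 := ((graph_eq_graph_iff Φ Ψ A _).1 h2.symm).2
  have hu : IsUnit (blockFst Φ Ψ A) :=
    isUnit_of_det_pos hA
  rw [h3, ContinuousLinearMap.comp_assoc]
  change _ = ContinuousLinearMap.comp _ (blockFst Φ Ψ A * Ring.inverse (blockFst Φ Ψ A))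
  rw [Ring.mul_inverse_cancel _ hu]
  rfl

theorem contDiff_blockFst
    (Φ Ψ : Splitting k E)
    {r : ℕ∞ω} : ContDiff ℝ r (blockFst Φ Ψ) := by
  have h : blockFst Φ Ψ = fun A => blockFst Φ Ψ 0 + ((ContinuousLinearMap.fst ℝ _ _).comp
      (Ψ.symm.toContinuousLinearMap.comp (Φ.toContinuousLinearMap.comp
        (ContinuousLinearMap.inr ℝ (EuclideanSpace ℝ (Fin k)) _)))).comp A := by
    ext1 A
    ext1 x
    have hx : Φ (x, A x) = Φ (x, 0) + Φ (0, A x) := by rw [← map_add]; simp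
    simp [blockFst, graphMap, hx]
  rw [h]
  exact contDiff_const.add (contDiff_const.clm_comp contDiff_id)

theorem contDiff_blockSnd
    (Φ Ψ : Splitting k E)
    {r : ℕ∞ω} : ContDiff ℝ r (blockSnd Φ Ψ) := by
  have h : blockSnd Φ Ψ = fun A => blockSnd Φ Ψ 0 + ((ContinuousLinearMap.snd ℝ _ _).comp
      (Ψ.symm.toContinuousLinearMap.comp (Φ.toContinuousLinearMap.comp
        (ContinuousLinearMap.inr ℝ (EuclideanSpace ℝ (Fin k)) _)))).comp A := by
    ext1 A
    ext1 x
    have hx : Φ (x, A x) = Φ (x, 0) + Φ (0, A x) := by rw [← map_add]; simp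
    simp [blockSnd, graphMap, hx]
  rw [h]
  exact contDiff_const.add (contDiff_const.clm_comp contDiff_id)

theorem isOpen_graphChart_trans_source
    (Φ Ψ : Splitting k E) :
    IsOpen ((graphChart Φ).symm.trans (graphChart Ψ)).source := by
  rw [graphChart_trans_source]
  have h : Continuous fun A => (blockFst Φ Ψ A).det :=
    ContinuousLinearMap.continuous_det.comp (contDiff_blockFst (r := 0) Φ Ψ).continuous
  exact isOpen_lt continuous_const h

theorem contDiffOn_graphChart_trans
    (Φ Ψ : Splitting k E)
    {r : ℕ∞ω} : ContDiffOn ℝ r ((graphChart Φ).symm.trans (graphChart Ψ))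
      ((graphChart Φ).symm.trans (graphChart Ψ)).source := by
  rw [graphChart_trans_source]
  refine ContDiffOn.congr (f := fun A => (blockSnd Φ Ψ A).comp (Ring.inverse (blockFst Φ Ψ A))) ?_
    (fun A hA => graphChart_trans_apply Φ Ψ A hA)
  intro A hA
  have hA' : 0 < (blockFst Φ Ψ A).det := hA
  obtain ⟨u, hu⟩ : IsUnit (blockFst Φ Ψ A) :=
    isUnit_of_det_pos hA'
  apply ContDiffAt.contDiffWithinAt
  have h1 : ContDiffAt ℝ r (fun A => Ring.inverse (blockFst Φ Ψ A)) A := by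
    have h2 := contDiffAt_ringInverse ℝ (n := r) u
    rw [hu] at h2
    exact h2.comp A (contDiff_blockFst Φ Ψ).contDiffAt
  exact (contDiff_blockSnd Φ Ψ).contDiffAt.clm_comp h1

theorem exists_graph_eq [NeZero k] [FiniteDimensional ℝ E] (V : OrientedGrassmannian k E) :
    ∃ Φ : Splitting k E,
      graph Φ 0 = V := by
  obtain ⟨W, hW⟩ := V.plane.exists_isCompl
  have hWr : finrank ℝ W = finrank ℝ E - k := by
    have := Submodule.finrank_add_eq_of_isCompl hW
    have := V.finrank_plane
    omega
  let b : Basis (Fin k) ℝ V.plane := V.orientation.someBasis (by simp [V.finrank_plane])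
  have hb : b.orientation = V.orientation := V.orientation.someBasis_orientation _
  let c : Basis (Fin (finrank ℝ E - k)) ℝ W := finBasisOfFinrankEq ℝ W hWr
  let f := (EuclideanSpace.basisFun (Fin k) ℝ).toBasis.equiv b (Equiv.refl _)
  let g := (EuclideanSpace.basisFun (Fin (finrank ℝ E - k)) ℝ).toBasis.equiv c (Equiv.refl _)
  let Φ := ((f.prodCongr g).trans (Submodule.prodEquivOfIsCompl _ _ hW)).toContinuousLinearEquiv
  have hΦ : ∀ x, graphMap Φ 0 x = f x := by
    intro x
    simp [graphMap, Φ]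
  refine ⟨Φ, ?_⟩
  have h : LinearMap.range (graphMap Φ 0 : EuclideanSpace ℝ (Fin k) →ₗ[ℝ] E) = V.plane := by
    ext y
    constructor
    · rintro ⟨x, rfl⟩
      change graphMap Φ 0 x ∈ _
      rw [hΦ]
      exact (f x).2
    · intro hy
      refine ⟨f.symm ⟨y, hy⟩, ?_⟩
      change graphMap Φ 0 _ = _
      rw [hΦ]
      simp
  refine (mk_eq_mk_iff _ V.finrank_plane _ V.orientation).2 ⟨h, ?_⟩
  rw [← hb]
  rw [← Basis.orientation_map]
  congr 1
  ext i
  change graphMap Φ 0 ((EuclideanSpace.basisFun (Fin k) ℝ).toBasis i) = _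
  rw [hΦ]
  simp only [f, Basis.equiv_apply, Equiv.refl_apply]

/-- The atlas of all affine charts. -/
def chartedSpaceCore (k : ℕ) [NeZero k] (E : Type*) [NormedAddCommGroup E] [NormedSpace ℝ E]
    [FiniteDimensional ℝ E] : ChartedSpaceCore (Model k E) (OrientedGrassmannian k E) where
  atlas := Set.range graphChart
  chartAt V := graphChart (exists_graph_eq V).choose
  mem_chart_source V := ⟨0, (exists_graph_eq V).choose_spec⟩
  chart_mem_atlas V := ⟨_, rfl⟩
  open_source := by
    rintro _ _ ⟨Φ, rfl⟩ ⟨Ψ, rfl⟩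
    exact isOpen_graphChart_trans_source Φ Ψ
  continuousOn_toFun := by
    rintro _ _ ⟨Φ, rfl⟩ ⟨Ψ, rfl⟩
    exact (contDiffOn_graphChart_trans (r := 0) Φ Ψ).continuousOn

variable [NeZero k] [FiniteDimensional ℝ E]

instance : TopologicalSpace (OrientedGrassmannian k E) :=
  (chartedSpaceCore k E).toTopologicalSpace

instance : ChartedSpace (Model k E) (OrientedGrassmannian k E) :=
  (chartedSpaceCore k E).toChartedSpace

instance : IsManifold 𝓘(ℝ, Model k E) ∞ (OrientedGrassmannian k E) := by
  apply isManifold_of_contDiffOn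
  rintro e e' he he'
  obtain ⟨Φ, hΦ⟩ : ∃ Φ : Splitting k E, e.toPartialEquiv = graphChart Φ := by
    change e ∈ ⋃ (a : PartialEquiv (OrientedGrassmannian k E) (Model k E))
      (ha : a ∈ (chartedSpaceCore k E).atlas), {(chartedSpaceCore k E).openPartialHomeomorph a ha} at he
    simp only [Set.mem_iUnion, Set.mem_singleton_iff] at he
    obtain ⟨_, ⟨Φ, rfl⟩, rfl⟩ := he
    exact ⟨Φ, rfl⟩
  obtain ⟨Ψ, hΨ⟩ : ∃ Ψ : Splitting k E, e'.toPartialEquiv = graphChart Ψ := by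
    change e' ∈ ⋃ (a : PartialEquiv (OrientedGrassmannian k E) (Model k E))
      (ha : a ∈ (chartedSpaceCore k E).atlas), {(chartedSpaceCore k E).openPartialHomeomorph a ha} at he'
    simp only [Set.mem_iUnion, Set.mem_singleton_iff] at he'
    obtain ⟨_, ⟨Ψ, rfl⟩, rfl⟩ := he'
    exact ⟨Ψ, rfl⟩
  have h := contDiffOn_graphChart_trans Φ Ψ (r := ∞)
  rw [← hΦ, ← hΨ] at h
  refine h.mono ?_
  intro A hA
  exact hA.1

end OrientedGrassmannian

/-! ### Legendrian immersions into the unit sphere of `ℂ^(n+1)` -/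

namespace Legendrian

/-- `ℂ^(n+1) = ℝ^(2n+2)`. As a real vector space it carries the Euclidean inner product
`⟨z, w⟩ = Re ∑ conj (z_k) w_k`. -/
abbrev AmbientSpace (n : ℕ) : Type := EuclideanSpace ℂ (Fin (n + 1))

variable {n : ℕ} {M : Type*} [TopologicalSpace M] [ChartedSpace (EuclideanSpace ℝ (Fin n)) M]

/-- The differential `dF_p : T_p M → ℂ^(n+1)`. -/
abbrev diff (F : M → AmbientSpace n) (p : M) : TangentSpace (𝓡 n) p →L[ℝ] AmbientSpace n :=
  mfderiv (𝓡 n) 𝓘(ℝ, AmbientSpace n) F p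

/-- The tangent space of the immersed submanifold at `p`, as a subspace of `ℂ^(n+1)`. -/
def tangentPlane (F : M → AmbientSpace n) (p : M) : Submodule ℝ (AmbientSpace n) :=
  LinearMap.range (diff F p : TangentSpace (𝓡 n) p →ₗ[ℝ] AmbientSpace n)

/-- The normal space `N_p M` of the immersed submanifold in the unit sphere: the orthogonal complement
of `T_p M ⊕ ℝ F(p)` in `ℂ^(n+1)`. -/
def normalSpace (F : M → AmbientSpace n) (p : M) : Submodule ℝ (AmbientSpace n) :=
  (tangentPlane F p ⊔ Submodule.span ℝ {F p})ᗮ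

/-- `F` is a smooth Legendrian immersion of the `n`-manifold `M` into the unit sphere `S^(2n+1)`.
The Riemannian metric of `M` is the one induced by `F`. -/
structure IsLegendrianImmersion (F : M → AmbientSpace n) : Prop where
  contMDiff : ContMDiff (𝓡 n) 𝓘(ℝ, AmbientSpace n) ∞ F
  injective_diff : ∀ p, Function.Injective (diff F p)
  norm_eq_one : ∀ p, ‖F p‖ = 1
  J_diff_mem : ∀ p, ∀ v : TangentSpace (𝓡 n) p, Complex.I • diff F p v ∈ normalSpace F p
  J_mem : ∀ p, Complex.I • F p ∈ normalSpace F p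

theorem IsLegendrianImmersion.inner_diff {F : M → AmbientSpace n} (hF : IsLegendrianImmersion F)
    (p : M) (v : TangentSpace (𝓡 n) p) : inner ℝ (F p) (diff F p v) = 0 := by
  have h1 : HasMFDerivAt (𝓡 n) 𝓘(ℝ, AmbientSpace n) F p (diff F p) :=
    ((hF.contMDiff p).mdifferentiableAt (by simp)).hasMFDerivAt
  have h2 : HasFDerivAt (fun z : AmbientSpace n => ‖z‖ ^ 2) (2 • innerSL ℝ (F p)) (F p) :=
    (hasStrictFDerivAt_norm_sq (F p)).hasFDerivAt
  have h3 := h2.hasMFDerivAt.comp p h1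
  have h4 : (fun z : AmbientSpace n => ‖z‖ ^ 2) ∘ F = fun _ => (1 : ℝ) := by
    ext q
    simp [hF.norm_eq_one q]
  rw [h4] at h3
  have h5 := hasMFDerivAt_unique h3 (hasMFDerivAt_const (1 : ℝ) p)
  have h6 : (2 • innerSL ℝ (F p)) (diff F p v) = 0 := DFunLike.congr_fun h5 v
  simpa using h6

theorem finrank_ambientSpace (n : ℕ) : finrank ℝ (AmbientSpace n) = 2 * (n + 1) := by
  rw [← finrank_mul_finrank ℝ ℂ (AmbientSpace n)]
  simp

theorem IsLegendrianImmersion.finrank_normalSpace {F : M → AmbientSpace n}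
    (hF : IsLegendrianImmersion F) (p : M) : finrank ℝ (normalSpace F p) = n + 1 := by
  have h1 : finrank ℝ (tangentPlane F p) = n := by
    rw [tangentPlane, LinearMap.finrank_range_of_inj (hF.injective_diff p)]
    change finrank ℝ (EuclideanSpace ℝ (Fin n)) = n
    simp
  have h0 : F p ≠ 0 := by
    intro h
    have := hF.norm_eq_one p
    simp [h] at this
  have h2 : finrank ℝ (Submodule.span ℝ {F p}) = 1 := finrank_span_singleton h0
  have h3 : tangentPlane F p ⊓ Submodule.span ℝ {F p} = ⊥ := by
    rw [eq_bot_iff]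
    rintro x ⟨⟨v, hv⟩, hx⟩
    obtain ⟨c, rfl⟩ := Submodule.mem_span_singleton.1 hx
    have h4 : diff F p v = c • F p := hv
    have h5 := hF.inner_diff p v
    rw [h4, inner_smul_right, real_inner_self_eq_norm_sq, hF.norm_eq_one p] at h5
    have : c = 0 := by simpa using h5
    simp [this]
  have h4 := Submodule.finrank_sup_add_finrank_inf_eq (tangentPlane F p) (Submodule.span ℝ {F p})
  have h5 := Submodule.finrank_add_finrank_orthogonal (tangentPlane F p ⊔ Submodule.span ℝ {F p})
  rw [h3, h1, h2, finrank_bot, add_zero] at h4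
  rw [finrank_ambientSpace, h4] at h5
  change finrank ℝ ((tangentPlane F p ⊔ Submodule.span ℝ {F p})ᗮ : Submodule ℝ _) = _
  omega

/-- The derivative `∂_u (dF Y)` in `ℂ^(n+1)`, where `Y` is the vector field near `p` with `Y_p = v`
whose components in the preferred chart at `p` are constant; in that chart this is the second
derivative of `F` in the directions `u` and `v`. (In Mathlib, tangent vectors at `p` are identified
with elements of `ℝ^n` through the preferred chart at `p`.) -/
def ambientDerivative (F : M → AmbientSpace n) (p : M) (u v : TangentSpace (𝓡 n) p) :
    AmbientSpace n :=
  fderiv ℝ (fun x => fderiv ℝ (F ∘ (extChartAt (𝓡 n) p).symm) x v) (extChartAt (𝓡 n) p p) u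

/-- The second fundamental form of the immersed submanifold in the unit sphere: the component of
`∂_u Y` in the normal space `N_p M`. -/
def secondFundamentalForm (F : M → AmbientSpace n) (p : M) (u v : TangentSpace (𝓡 n) p) :
    AmbientSpace n :=
  (normalSpace F p).starProjection (ambientDerivative F p u v)

/-- `σ(X, Y, Z) = ⟨B(X, Y), J Z⟩`. -/
def sigma (F : M → AmbientSpace n) (p : M) (X Y Z : TangentSpace (𝓡 n) p) : ℝ :=
  inner ℝ (secondFundamentalForm F p X Y) (Complex.I • diff F p Z)

/-- `e` is an orthonormal basis of `T_p M` for the metric induced by `F`. -/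
def IsOrthonormalFrameAt (F : M → AmbientSpace n) (p : M) (e : Fin n → TangentSpace (𝓡 n) p) : Prop :=
  Orthonormal ℝ fun i => diff F p (e i)

/-- The fundamental matrix `S_ab = ∑_{i,j} σ(e_i, e_j, e_a) σ(e_i, e_j, e_b)` with respect to `e`. -/
def fundamentalMatrix (F : M → AmbientSpace n) (p : M) (e : Fin n → TangentSpace (𝓡 n) p) :
    Matrix (Fin n) (Fin n) ℝ :=
  Matrix.of fun a b => ∑ i, ∑ j, sigma F p (e i) (e j) (e a) * sigma F p (e i) (e j) (e b)

theorem isHermitian_fundamentalMatrix (F : M → AmbientSpace n) (p : M)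
    (e : Fin n → TangentSpace (𝓡 n) p) : (fundamentalMatrix F p e).IsHermitian := by
  ext a b
  simp [fundamentalMatrix, mul_comm]

/-- The orientations `o q` of the normal spaces `N_q M` form a continuous orientation of the normal
bundle over some neighbourhood `U` of `p`: over `U` there is a continuous frame of the normal bundle
which is everywhere positively oriented. -/
def IsOrientationNear (F : M → AmbientSpace n) (o : ∀ q, Orientation ℝ (normalSpace F q) (Fin (n + 1)))
    (p : M) : Prop :=
  ∃ U ∈ 𝓝 p, ∃ ν : Fin (n + 1) → M → AmbientSpace n, (∀ i, ContinuousOn (ν i) U) ∧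
    ∀ q ∈ U, ∃ b : Basis (Fin (n + 1)) ℝ (normalSpace F q),
      b.orientation = o q ∧ ∀ i, (b i : AmbientSpace n) = ν i q

/-- The Gauss map `q ↦ N_q M` into the Grassmann manifold of oriented `(n+1)`-planes in
`ℂ^(n+1) = ℝ^(2n+2)`, for given orientations of the normal spaces. -/
def gaussMap {F : M → AmbientSpace n} (hF : IsLegendrianImmersion F)
    (o : ∀ q, Orientation ℝ (normalSpace F q) (Fin (n + 1))) (q : M) :
    OrientedGrassmannian (n + 1) (AmbientSpace n) where
  plane := normalSpace F q
  finrank_plane := hF.finrank_normalSpace q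
  orientation := o q

end Legendrian

end

/-! The Legendrian condition says that `J` maps `T ⊕ ℝF` into the normal space `N`. Both have
dimension `n + 1`, so `N = J (T ⊕ ℝF)` (`normalSpace_eq_map`), and in a chart at `p` the normal
spaces are the images of the explicit injections `L x (v, t) = J (dF_x v + t F(x))` (`normalFrame`).

In the affine chart of the Grassmannian centred at `N_p`, the image of `L x` is the graph of `A x =
Q x ∘ (P x)⁻¹`, where `P` and `Q` are the two components of `L`. Since `Q` vanishes at the base
point, `A' u = 0` exactly when `L' u` takes values in `N_p` (`exists_hasFDerivAt_graphMap`). Now `L'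
u (v, t) = J (Hess(u, v)) + t J (dF u)`. The second term is always normal. The first is normal if
and only if `σ(u, v, w) = ⟨Hess(u, v), J dF w⟩` vanishes for all `w`, because `Hess(u, v)` is
already orthogonal to `J F`. As `σ` is totally symmetric, the kernel of the differential is the
radical `{u | σ(·, ·, u) = 0}` (`exists_hasMFDerivAt_gaussMap`).

In the frame `e` this radical is the kernel of the `n² × n` matrix `T` with entries `σ(e_i, e_j,
e_a)`, so the differential has the rank of `T`. Since `S = Tᵀ T` is positive semidefinite and has
the rank of `T`, that rank is the number of positive eigenvalues of `S`.

Orientations matter only for landing in the right oriented chart: the sign of a determinant,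
continuous along the given positive frames, cannot change near `p` (`eventually_eq_graph`). -/

noncomputable section

namespace OrientedGrassmannian

/-! ### Families of planes as graphs, and differentiability in the affine charts. -/

section Graphs

variable {k : ℕ} {E : Type*} [NormedAddCommGroup E] [NormedSpace ℝ E]

theorem mem_range_graphMap_iff (Φ : Splitting k E) (A : Model k E) (y : E) :
    y ∈ Set.range (graphMap Φ A) ↔ (Φ.symm y).2 = A (Φ.symm y).1 := by
  constructor
  · rintro ⟨x, rfl⟩
    simp [graphMap]
  · intro h
    refine ⟨(Φ.symm y).1, ?_⟩
    apply Φ.symm.injective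
    ext1 <;> simp [graphMap, h]

/-- A differentiable family of injective linear maps `L x : ℝ^k → E` sweeps out, near a point where
its image is the graph of `0`, the graphs of a differentiable family of linear maps. The derivative
of the latter kills exactly the directions along which `L` stays in the plane to first order. -/
theorem exists_hasFDerivAt_graphMap {X : Type*} [NormedAddCommGroup X] [NormedSpace ℝ X]
    (Φ : Splitting k E) {L : X → EuclideanSpace ℝ (Fin k) →L[ℝ] E}
    {L' : X →L[ℝ] EuclideanSpace ℝ (Fin k) →L[ℝ] E} {x₀ : X} (hL : HasFDerivAt L L' x₀)
    (hinj : Function.Injective (L x₀))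
    (hrange : Set.range (L x₀) = Set.range (graphMap Φ 0)) :
    ∃ (A : X → Model k E) (A' : X →L[ℝ] Model k E), A x₀ = 0 ∧ HasFDerivAt A A' x₀ ∧
      (∀ᶠ x in 𝓝 x₀, Set.range (L x) = Set.range (graphMap Φ (A x))) ∧
      ∀ u, A' u = 0 ↔ ∀ y, L' u y ∈ Set.range (L x₀) := by
  -- Coordinates of the splitting; the plane `L x₀` is the kernel of `π₂`.
  let π₁ : E →L[ℝ] EuclideanSpace ℝ (Fin k) :=
    (ContinuousLinearMap.fst ℝ _ _).comp Φ.symm.toContinuousLinearMap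
  let π₂ : E →L[ℝ] EuclideanSpace ℝ (Fin (finrank ℝ E - k)) :=
    (ContinuousLinearMap.snd ℝ _ _).comp Φ.symm.toContinuousLinearMap
  let P : X → EuclideanSpace ℝ (Fin k) →L[ℝ] EuclideanSpace ℝ (Fin k) := fun x => π₁.comp (L x)
  let Q : X → Model k E := fun x => π₂.comp (L x)
  have hmem : ∀ y, y ∈ Set.range (L x₀) ↔ π₂ y = 0 := by
    intro y
    rw [hrange, mem_range_graphMap_iff]
    rfl
  have hQ₀ : Q x₀ = 0 := by
    ext1 y
    exact (hmem _).1 ⟨y, rfl⟩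
  have hPinj : Function.Injective (P x₀) := by
    intro y z h
    apply hinj
    apply Φ.symm.injective
    refine Prod.ext h ?_
    exact ((hmem _).1 ⟨y, rfl⟩).trans ((hmem _).1 ⟨z, rfl⟩).symm
  have hP₀ : IsUnit (P x₀) := by
    let eq := (LinearEquiv.ofInjectiveEndo
      (P x₀ : EuclideanSpace ℝ (Fin k) →ₗ[ℝ] EuclideanSpace ℝ (Fin k)) hPinj).toContinuousLinearEquiv
    exact ⟨ContinuousLinearEquiv.toUnit eq, by ext1 x; rfl⟩
  obtain ⟨w, hw⟩ := hP₀
  have hP : HasFDerivAt P ((ContinuousLinearMap.compL ℝ _ _ _ π₁).comp L') x₀ :=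
    HasFDerivAt.comp x₀ (g := ContinuousLinearMap.compL ℝ _ _ _ π₁)
      (ContinuousLinearMap.hasFDerivAt _) hL
  have hQ : HasFDerivAt Q ((ContinuousLinearMap.compL ℝ _ _ _ π₂).comp L') x₀ :=
    HasFDerivAt.comp x₀ (g := ContinuousLinearMap.compL ℝ _ _ _ π₂)
      (ContinuousLinearMap.hasFDerivAt _) hL
  have hinv : DifferentiableAt ℝ (fun x => Ring.inverse (P x)) x₀ := by
    have h := (hasFDerivAt_ringInverse (𝕜 := ℝ) w).differentiableAt
    rw [hw] at h
    exact h.comp x₀ hP.differentiableAt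
  -- The family sought is `A = Q ∘ P⁻¹`. `Ring.inverse` is total, and is a true inverse near `x₀`
  -- because units form an open set.
  have hA := hQ.clm_comp hinv.hasFDerivAt
  have hunit : ∀ᶠ x in 𝓝 x₀, IsUnit (P x) :=
    hP.continuousAt.eventually (hw ▸ Units.isOpen.mem_nhds w.isUnit)
  refine ⟨_, _, ?_, hA, ?_, ?_⟩
  · simp [hQ₀]
  · filter_upwards [hunit] with x hx
    have h1 : ∀ y, Ring.inverse (P x) (P x y) = y := fun y =>
      DFunLike.congr_fun (Ring.inverse_mul_cancel _ hx) y
    have h2 : ∀ y, P x (Ring.inverse (P x) y) = y := fun y =>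
      DFunLike.congr_fun (Ring.mul_inverse_cancel _ hx) y
    ext z
    rw [mem_range_graphMap_iff]
    constructor
    · rintro ⟨y, rfl⟩
      change Q x y = Q x (Ring.inverse (P x) (P x y))
      rw [h1]
    · intro hz
      refine ⟨Ring.inverse (P x) (Φ.symm z).1, ?_⟩
      apply Φ.symm.injective
      exact Prod.ext (h2 _) hz.symm
  · intro u
    -- In the product rule, the term containing the derivative of `P⁻¹` is multiplied by `Q x₀ = 0`
    -- and drops out.
    have hform : ∀ y, ((ContinuousLinearMap.compL ℝ _ _ _ (Q x₀)).comp
        (fderiv ℝ (fun x => Ring.inverse (P x)) x₀) +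
        ((ContinuousLinearMap.compL ℝ _ _ _).flip (Ring.inverse (P x₀))).comp
          ((ContinuousLinearMap.compL ℝ _ _ _ π₂).comp L')) u y
        = π₂ (L' u (Ring.inverse (P x₀) y)) := by
      intro y
      simp [hQ₀]
    have h1 : ∀ y, Ring.inverse (P x₀) (P x₀ y) = y := fun y =>
      DFunLike.congr_fun (Ring.inverse_mul_cancel _ (hw ▸ w.isUnit)) y
    constructor
    · intro h y
      rw [hmem, ← h1 y, ← hform, h]
      rfl
    · intro h
      ext1 y
      rw [hform]
      exact (hmem _).1 (h _)

/-- Turns a positive basis into a presentation by `ofInjective`, for which `ofInjective_eq_iff`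
reduces equality of oriented planes to the sign of a determinant. -/
theorem exists_eq_ofInjective {V : OrientedGrassmannian k E}
    (b : Basis (Fin k) ℝ V.plane) (hb : b.orientation = V.orientation)
    (R : EuclideanSpace ℝ (Fin k) →L[ℝ] E) (hR : ∀ i, R (EuclideanSpace.basisFun (Fin k) ℝ i) = b i) :
    ∃ hinj : Function.Injective R, V = ofInjective R hinj := by
  have hRb : ∀ x, R x = ((EuclideanSpace.basisFun (Fin k) ℝ).toBasis.equiv b (Equiv.refl _) x : E) := by
    intro x
    have : (R : EuclideanSpace ℝ (Fin k) →ₗ[ℝ] E) = V.plane.subtype ∘ₗ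
        ((EuclideanSpace.basisFun (Fin k) ℝ).toBasis.equiv b (Equiv.refl _)).toLinearMap := by
      refine (EuclideanSpace.basisFun (Fin k) ℝ).toBasis.ext fun i => ?_
      change R ((EuclideanSpace.basisFun (Fin k) ℝ).toBasis i) =
        ((EuclideanSpace.basisFun (Fin k) ℝ).toBasis.equiv b (Equiv.refl _)
          ((EuclideanSpace.basisFun (Fin k) ℝ).toBasis i) : E)
      rw [Basis.equiv_apply, OrthonormalBasis.coe_toBasis, hR]
      rfl
    exact LinearMap.congr_fun this x
  have hinj : Function.Injective R := by
    intro x y hxy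
    rw [hRb, hRb] at hxy
    exact LinearEquiv.injective _ (Subtype.ext hxy)
  refine ⟨hinj, ?_⟩
  have hpl : V.plane = LinearMap.range (R : EuclideanSpace ℝ (Fin k) →ₗ[ℝ] E) := by
    ext y
    constructor
    · intro hy
      refine ⟨((EuclideanSpace.basisFun (Fin k) ℝ).toBasis.equiv b (Equiv.refl _)).symm ⟨y, hy⟩, ?_⟩
      change R _ = _
      rw [hRb, LinearEquiv.apply_symm_apply]
    · rintro ⟨x, rfl⟩
      change R x ∈ _
      rw [hRb]
      exact Subtype.property _
  refine (mk_eq_mk_iff V.finrank_plane _ V.orientation _).2 ⟨hpl, ?_⟩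
  rw [← hb, ← Basis.orientation_map]
  congr 1
  ext i
  change (b i : E) = R _
  rw [← hR]
  simp

/-- If a family of oriented planes is spanned by positively oriented frames which are continuous at
`p`, and its planes are graphs, then near `p` it consists of the corresponding oriented graphs. -/
theorem eventually_eq_graph {X : Type*} [TopologicalSpace X] {p : X}
    {V : X → OrientedGrassmannian k E} {R : X → EuclideanSpace ℝ (Fin k) →L[ℝ] E}
    (hR : ContinuousAt R p)
    (hV : ∀ᶠ q in 𝓝 p, ∃ h : Function.Injective (R q), V q = ofInjective (R q) h)
    (Φ : Splitting k E) {A : X → Model k E} (hp : graph Φ (A p) = V p)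
    (hA : ∀ᶠ q in 𝓝 p, ((V q).plane : Set E) = Set.range (graphMap Φ (A q))) :
    ∀ᶠ q in 𝓝 p, graph Φ (A q) = V q := by
  let π₁ : E →L[ℝ] EuclideanSpace ℝ (Fin k) :=
    (ContinuousLinearMap.fst ℝ _ _).comp Φ.symm.toContinuousLinearMap
  have hcont : ContinuousAt (fun q => (π₁.comp (R q)).det) p :=
    ContinuousLinearMap.continuous_det.continuousAt.comp
      ((ContinuousLinearMap.compL ℝ _ _ _ π₁).continuous.continuousAt.comp hR)
  -- At `p` the oriented planes agree, so the change of frame has positive determinant. A graph is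
  -- parametrised by its first coordinate, so this change of frame is `π₁ ∘ R p`.
  have hpos : 0 < (π₁.comp (R p)).det := by
    obtain ⟨hi, h⟩ := hV.self_of_nhds
    rw [← hp, eq_comm, graph, ofInjective_eq_iff] at h
    obtain ⟨g, hg, h⟩ := h
    have : π₁.comp (R p) = g := by
      ext1 x
      rw [h]
      simp [π₁, graphMap]
    rw [this]
    exact hg
  filter_upwards [hV, hA, hcont.eventually (isOpen_Ioi.mem_nhds hpos)] with q hVq hAq hdet
  obtain ⟨hi, h⟩ := hVq
  rw [h, eq_comm, graph, ofInjective_eq_iff]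
  refine ⟨π₁.comp (R q), hdet, ?_⟩
  ext1 x
  have hx : R q x ∈ Set.range (graphMap Φ (A q)) := by
    rw [← hAq, h]
    exact ⟨x, rfl⟩
  rw [mem_range_graphMap_iff] at hx
  apply Φ.symm.injective
  refine Prod.ext ?_ ?_
  · simp [π₁, graphMap]
  · simpa [π₁, graphMap] using hx

end Graphs

/-- A map into the Grassmannian which is the oriented graph of a differentiable family of linear maps
is differentiable. -/
theorem hasMFDerivAt_of_eventually_eq_graph {k : ℕ} [NeZero k] {E : Type*} [NormedAddCommGroup E]
    [NormedSpace ℝ E] [FiniteDimensional ℝ E] {n : ℕ} {M : Type*} [TopologicalSpace M]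
    [ChartedSpace (EuclideanSpace ℝ (Fin n)) M] {p : M} {V : M → OrientedGrassmannian k E}
    {A : EuclideanSpace ℝ (Fin n) → Model k E} {A' : EuclideanSpace ℝ (Fin n) →L[ℝ] Model k E}
    (hA : HasFDerivAt A A' (extChartAt (𝓡 n) p p))
    (hV : ∀ᶠ q in 𝓝 p, graph (exists_graph_eq (V p)).choose (A (extChartAt (𝓡 n) p q)) = V q) :
    HasMFDerivAt (𝓡 n) 𝓘(ℝ, Model k E) V p A' := by
  set Φ := (exists_graph_eq (V p)).choose
  -- `graph Φ` is the inverse of the preferred chart at `V p`, whose target is the whole model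
  -- space.
  have hc : Continuous (graph Φ) := by
    have h := (chartAt (Model k E) (V p)).continuousOn_symm
    have ht : (chartAt (Model k E) (V p)).target = Set.univ := rfl
    rw [ht, ← continuousOn_univ.symm] at h
    exact h
  have hcA : ContinuousAt (fun q => A (extChartAt (𝓡 n) p q)) p :=
    ContinuousAt.comp (g := A) hA.continuousAt (continuousAt_extChartAt p)
  refine ⟨(ContinuousAt.congr (hc.continuousAt.comp hcA) hV), ?_⟩
  refine HasFDerivAt.hasFDerivWithinAt ?_
  refine hA.congr_of_eventuallyEq ?_
  have h1 : Filter.Tendsto (extChartAt (𝓡 n) p).symm (𝓝 (extChartAt (𝓡 n) p p)) (𝓝 p) := by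
    have := continuousAt_extChartAt_symm (I := 𝓡 n) p
    rw [ContinuousAt, extChartAt_to_inv] at this
    exact this
  have h2 : (extChartAt (𝓡 n) p).target ∈ 𝓝 (extChartAt (𝓡 n) p p) := extChartAt_target_mem_nhds p
  filter_upwards [h1.eventually hV, h2] with x hx hxt
  rw [(extChartAt (𝓡 n) p).right_inv hxt] at hx
  change Function.invFun (graph Φ) (V ((extChartAt (𝓡 n) p).symm x)) = A x
  rw [← hx]
  exact Function.leftInverse_invFun (graph_injective Φ) _

end OrientedGrassmannian
end

noncomputable section

/-! ### The complex structure and the normal space of a Legendrian immersion. -/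

namespace Legendrian

theorem inner_I_smul_left {n : ℕ} (x y : AmbientSpace n) :
    inner ℝ (Complex.I • x) y = -inner ℝ x (Complex.I • y) := by
  simp only [PiLp.inner_apply, Complex.inner, ← Finset.sum_neg_distrib]
  refine Finset.sum_congr rfl fun i _ => ?_
  simp
  ring

/-- The complex structure of `ℂ^(n+1)` as a real linear map. -/
def complexStructure (n : ℕ) : AmbientSpace n →L[ℝ] AmbientSpace n :=
  Complex.I • ContinuousLinearMap.id ℝ (AmbientSpace n)

@[simp]
theorem complexStructure_apply {n : ℕ} (x : AmbientSpace n) :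
    complexStructure n x = Complex.I • x := rfl

theorem complexStructure_injective (n : ℕ) : Function.Injective (complexStructure n) :=
  smul_right_injective (M := AmbientSpace n) Complex.I_ne_zero

variable {n : ℕ} {M : Type*} [TopologicalSpace M] [ChartedSpace (EuclideanSpace ℝ (Fin n)) M]

theorem mem_normalSpace_iff (F : M → AmbientSpace n) (p : M) (z : AmbientSpace n) :
    z ∈ normalSpace F p ↔ (∀ v, inner ℝ (diff F p v) z = 0) ∧ inner ℝ (F p) z = 0 := by
  rw [normalSpace, ← Submodule.inf_orthogonal, Submodule.mem_inf, Submodule.mem_orthogonal,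
    Submodule.mem_orthogonal_singleton_iff_inner_right]
  refine and_congr ?_ Iff.rfl
  constructor
  · intro h v
    exact h _ ⟨v, rfl⟩
  · rintro h _ ⟨v, rfl⟩
    exact h v

/-- The Legendrian condition gives one inclusion, and both sides have dimension `n + 1`, half of `2n
+ 2`. -/
theorem IsLegendrianImmersion.normalSpace_eq_map {F : M → AmbientSpace n}
    (hF : IsLegendrianImmersion F) (p : M) :
    normalSpace F p = (tangentPlane F p ⊔ Submodule.span ℝ {F p}).map
      (complexStructure n : AmbientSpace n →ₗ[ℝ] AmbientSpace n) := by
  symm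
  apply Submodule.eq_of_le_of_finrank_eq
  · rw [Submodule.map_sup, sup_le_iff]
    constructor
    · rintro _ ⟨_, ⟨v, rfl⟩, rfl⟩
      exact hF.J_diff_mem p v
    · rw [Submodule.map_span, Submodule.span_le]
      rintro _ ⟨_, rfl, rfl⟩
      exact hF.J_mem p
  · have h1 := Submodule.finrank_add_finrank_orthogonal (tangentPlane F p ⊔ Submodule.span ℝ {F p})
    have h2 : finrank ℝ ((tangentPlane F p ⊔ Submodule.span ℝ {F p})ᗮ : Submodule ℝ _) = n + 1 :=
      hF.finrank_normalSpace p
    have h3 := (Submodule.equivMapOfInjective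
      (complexStructure n : AmbientSpace n →ₗ[ℝ] AmbientSpace n) (complexStructure_injective n)
      (tangentPlane F p ⊔ Submodule.span ℝ {F p})).finrank_eq
    rw [hF.finrank_normalSpace p]
    rw [finrank_ambientSpace, h2] at h1
    omega

/-- The expression of `F` in the preferred chart at `p`. -/
def localRep (F : M → AmbientSpace n) (p : M) : EuclideanSpace ℝ (Fin n) → AmbientSpace n :=
  F ∘ (extChartAt (𝓡 n) p).symm

theorem localRep_self (F : M → AmbientSpace n) (p : M) :
    localRep F p (extChartAt (𝓡 n) p p) = F p := by
  simp [localRep]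

theorem diff_eq_fderiv {F : M → AmbientSpace n}
    (hF : ContMDiff (𝓡 n) 𝓘(ℝ, AmbientSpace n) ∞ F) (p : M) :
    diff F p = fderiv ℝ (localRep F p) (extChartAt (𝓡 n) p p) := by
  rw [diff, ((hF p).mdifferentiableAt (by simp)).mfderiv]
  simp only [writtenInExtChartAt, extChartAt_model_space_eq_id, modelWithCornersSelf_coe,
    Set.range_id, fderivWithin_univ]
  rfl

/-- The second derivative of `F` in the preferred chart at `p`. -/
def hessian (F : M → AmbientSpace n) (p : M) :
    EuclideanSpace ℝ (Fin n) →L[ℝ] EuclideanSpace ℝ (Fin n) →L[ℝ] AmbientSpace n :=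
  fderiv ℝ (fderiv ℝ (localRep F p)) (extChartAt (𝓡 n) p p)

/-! ### The cubic form and its symmetries in the preferred chart. -/

section Chart

variable [IsManifold (𝓡 n) ∞ M] {F : M → AmbientSpace n}

theorem contDiffAt_localRep (hF : ContMDiff (𝓡 n) 𝓘(ℝ, AmbientSpace n) ∞ F) (p : M)
    {x : EuclideanSpace ℝ (Fin n)} (hx : x ∈ (extChartAt (𝓡 n) p).target) :
    ContDiffAt ℝ ∞ (localRep F p) x := by
  have h := hF.comp_contMDiffOn (contMDiffOn_extChartAt_symm (I := 𝓡 n) (n := ∞) p)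
  rw [contMDiffOn_iff_contDiffOn] at h
  exact h.contDiffAt ((isOpen_extChartAt_target p).mem_nhds hx)

/-- At a point `q` near `p`, `diff F q` refers to the preferred chart at `q`, not at `p`. The two
derivatives differ by the invertible derivative of the inverse chart, so their ranges agree. -/
theorem range_fderiv_localRep (hF : ContMDiff (𝓡 n) 𝓘(ℝ, AmbientSpace n) ∞ F) (p : M)
    {x : EuclideanSpace ℝ (Fin n)} (hx : x ∈ (extChartAt (𝓡 n) p).target) :
    LinearMap.range (fderiv ℝ (localRep F p) x : EuclideanSpace ℝ (Fin n) →ₗ[ℝ] AmbientSpace n)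
      = tangentPlane F ((extChartAt (𝓡 n) p).symm x) := by
  have : IsManifold (𝓡 n) 1 M := IsManifold.of_le (n := ∞) (by simp)
  have hinv := isInvertible_mfderivWithin_extChartAt_symm (I := 𝓡 n) hx
  have hs : MDifferentiableAt 𝓘(ℝ, EuclideanSpace ℝ (Fin n)) (𝓡 n) (extChartAt (𝓡 n) p).symm x :=
    (mdifferentiableOn_extChartAt_symm (I := 𝓡 n) x hx).mdifferentiableAt
      ((isOpen_extChartAt_target p).mem_nhds hx)
  rw [modelWithCornersSelf_coe, Set.range_id, mfderivWithin_univ] at hinv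
  obtain ⟨A, hA⟩ := hinv
  have hFd : MDifferentiableAt (𝓡 n) 𝓘(ℝ, AmbientSpace n) F ((extChartAt (𝓡 n) p).symm x) :=
    (hF _).mdifferentiableAt (by simp)
  have hcomp : ∀ v, fderiv ℝ (localRep F p) x v = diff F ((extChartAt (𝓡 n) p).symm x) (A v) := by
    intro v
    have h := mfderiv_comp x hFd hs
    rw [← hA, mfderiv_eq_fderiv] at h
    exact DFunLike.congr_fun h v
  ext z
  constructor
  · rintro ⟨v, rfl⟩
    exact ⟨A v, (hcomp v).symm⟩
  · rintro ⟨v, rfl⟩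
    refine ⟨A.symm v, (hcomp _).trans ?_⟩
    rw [A.apply_symm_apply]
    rfl

theorem mem_normalSpace_symm_iff (hF : ContMDiff (𝓡 n) 𝓘(ℝ, AmbientSpace n) ∞ F) (p : M)
    {x : EuclideanSpace ℝ (Fin n)} (hx : x ∈ (extChartAt (𝓡 n) p).target) (z : AmbientSpace n) :
    z ∈ normalSpace F ((extChartAt (𝓡 n) p).symm x) ↔
      (∀ v, inner ℝ (fderiv ℝ (localRep F p) x v) z = 0) ∧ inner ℝ (localRep F p x) z = 0 := by
  rw [mem_normalSpace_iff]
  refine and_congr ?_ Iff.rfl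
  have h := range_fderiv_localRep hF p hx
  constructor
  · intro hz v
    obtain ⟨w, hw⟩ : fderiv ℝ (localRep F p) x v ∈ tangentPlane F ((extChartAt (𝓡 n) p).symm x) :=
      h ▸ ⟨v, rfl⟩
    rw [← hw]
    exact hz w
  · intro hz v
    obtain ⟨w, hw⟩ : diff F ((extChartAt (𝓡 n) p).symm x) v ∈ LinearMap.range
        (fderiv ℝ (localRep F p) x : EuclideanSpace ℝ (Fin n) →ₗ[ℝ] AmbientSpace n) :=
      h ▸ ⟨v, rfl⟩
    rw [← hw]
    exact hz w

theorem hasFDerivAt_fderiv_localRep (hF : ContMDiff (𝓡 n) 𝓘(ℝ, AmbientSpace n) ∞ F) (p : M) :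
    HasFDerivAt (fderiv ℝ (localRep F p)) (hessian F p) (extChartAt (𝓡 n) p p) := by
  have h := contDiffAt_localRep hF p (mem_extChartAt_target p)
  exact ((h.fderiv_right (m := 1) (by decide)).differentiableAt (by simp)).hasFDerivAt

theorem hessian_symm (hF : ContMDiff (𝓡 n) 𝓘(ℝ, AmbientSpace n) ∞ F) (p : M)
    (u v : EuclideanSpace ℝ (Fin n)) : hessian F p u v = hessian F p v u :=
  (contDiffAt_localRep hF p (mem_extChartAt_target p)).isSymmSndFDerivAt (by simp; decide) u v

theorem hessian_apply (hF : ContMDiff (𝓡 n) 𝓘(ℝ, AmbientSpace n) ∞ F) (p : M)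
    (u v : EuclideanSpace ℝ (Fin n)) : hessian F p u v =
      fderiv ℝ (fun x => fderiv ℝ (localRep F p) x v) (extChartAt (𝓡 n) p p) u := by
  have h := (hasFDerivAt_fderiv_localRep hF p).clm_apply (hasFDerivAt_const v _)
  rw [h.fderiv]
  simp

/-- Differentiate `⟨dF v, J dF w⟩ = 0`, valid throughout the chart, in the direction `u`, and use
that `J` is skew. -/
theorem inner_hessian_I_smul_fderiv (hF : IsLegendrianImmersion F) (p : M)
    (u v w : EuclideanSpace ℝ (Fin n)) :
    inner ℝ (hessian F p u v)
        (Complex.I • fderiv ℝ (localRep F p) (extChartAt (𝓡 n) p p) w) =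
      inner ℝ (hessian F p u w)
        (Complex.I • fderiv ℝ (localRep F p) (extChartAt (𝓡 n) p p) v) := by
  have hd := hasFDerivAt_fderiv_localRep hF.contMDiff p
  have hnhds := extChartAt_target_mem_nhds (I := 𝓡 n) p
  set x₀ := extChartAt (𝓡 n) p p
  have hv := hd.clm_apply (hasFDerivAt_const v _)
  have hw := hd.clm_apply (hasFDerivAt_const w _)
  have h := hv.inner ℝ (HasFDerivAt.comp _ (complexStructure n).hasFDerivAt hw)
  have h0 : (fun x => inner ℝ (fderiv ℝ (localRep F p) x v)
      ((complexStructure n ∘ fun x => fderiv ℝ (localRep F p) x w) x))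
      =ᶠ[𝓝 x₀] fun _ => (0 : ℝ) := by
    filter_upwards [hnhds] with x hx
    have hmem : Complex.I • fderiv ℝ (localRep F p) x w
        ∈ normalSpace F ((extChartAt (𝓡 n) p).symm x) := by
      obtain ⟨w', hw'⟩ : fderiv ℝ (localRep F p) x w
          ∈ tangentPlane F ((extChartAt (𝓡 n) p).symm x) :=
        range_fderiv_localRep hF.contMDiff p hx ▸ ⟨w, rfl⟩
      rw [← hw']
      exact hF.J_diff_mem _ w'
    exact ((mem_normalSpace_symm_iff hF.contMDiff p hx _).1 hmem).1 v
  have h1 := DFunLike.congr_fun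
    (h.unique ((hasFDerivAt_const (0 : ℝ) _).congr_of_eventuallyEq h0)) u
  have h2 : inner ℝ (fderiv ℝ (localRep F p) x₀ v) (Complex.I • hessian F p u w) +
      inner ℝ (hessian F p u v) (Complex.I • fderiv ℝ (localRep F p) x₀ w) = 0 := by
    simpa using h1
  have h3 := inner_I_smul_left (hessian F p u w) (fderiv ℝ (localRep F p) x₀ v)
  rw [real_inner_comm] at h3
  linarith

/-- Differentiate `⟨dF v, J F⟩ = 0` in the direction `u`; the extra term `⟨dF v, J dF u⟩` vanishes.
-/
theorem inner_hessian_I_smul (hF : IsLegendrianImmersion F) (p : M)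
    (u v : EuclideanSpace ℝ (Fin n)) : inner ℝ (hessian F p u v) (Complex.I • F p) = 0 := by
  have hd := hasFDerivAt_fderiv_localRep hF.contMDiff p
  have hG := ((contDiffAt_localRep hF.contMDiff p (mem_extChartAt_target p)).differentiableAt
    (by simp)).hasFDerivAt
  have hnhds := extChartAt_target_mem_nhds (I := 𝓡 n) p
  have hself := localRep_self F p
  have hJ : inner ℝ (fderiv ℝ (localRep F p) (extChartAt (𝓡 n) p p) v)
      (Complex.I • fderiv ℝ (localRep F p) (extChartAt (𝓡 n) p p) u) = 0 := by
    have h := ((mem_normalSpace_iff F p _).1 (hF.J_diff_mem p u)).1 v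
    rwa [diff_eq_fderiv hF.contMDiff] at h
  set x₀ := extChartAt (𝓡 n) p p
  have hv := hd.clm_apply (hasFDerivAt_const v _)
  have h := hv.inner ℝ (HasFDerivAt.comp _ (complexStructure n).hasFDerivAt hG)
  have h0 : (fun x => inner ℝ (fderiv ℝ (localRep F p) x v)
      ((complexStructure n ∘ localRep F p) x)) =ᶠ[𝓝 x₀] fun _ => (0 : ℝ) := by
    filter_upwards [hnhds] with x hx
    exact ((mem_normalSpace_symm_iff hF.contMDiff p hx _).1 (hF.J_mem _)).1 v
  have h1 := DFunLike.congr_fun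
    (h.unique ((hasFDerivAt_const (0 : ℝ) _).congr_of_eventuallyEq h0)) u
  have h2 : inner ℝ (fderiv ℝ (localRep F p) x₀ v)
        (Complex.I • fderiv ℝ (localRep F p) x₀ u) +
      inner ℝ (hessian F p u v) (Complex.I • F p) = 0 := by
    simpa [hself] using h1
  linarith

/-- The normal projection is self-adjoint and fixes `J dF w`, so it may be dropped. -/
theorem sigma_eq_inner_hessian (hF : IsLegendrianImmersion F) (p : M)
    (u v w : TangentSpace (𝓡 n) p) :
    sigma F p u v w = inner ℝ (hessian F p u v) (Complex.I • diff F p w) := by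
  rw [sigma, secondFundamentalForm, Submodule.inner_starProjection_left_eq_right,
    Submodule.starProjection_eq_self_iff.2 (hF.J_diff_mem p w)]
  congr 1
  exact (hessian_apply hF.contMDiff p u v).symm

theorem sigma_swap_left (hF : IsLegendrianImmersion F) (p : M)
    (u v w : TangentSpace (𝓡 n) p) : sigma F p u v w = sigma F p v u w := by
  rw [sigma_eq_inner_hessian hF, sigma_eq_inner_hessian hF]
  congr 1
  exact hessian_symm hF.contMDiff p u v

theorem sigma_swap_right (hF : IsLegendrianImmersion F) (p : M)
    (u v w : TangentSpace (𝓡 n) p) : sigma F p u v w = sigma F p u w v := by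
  rw [sigma_eq_inner_hessian hF, sigma_eq_inner_hessian hF, diff_eq_fderiv hF.contMDiff]
  exact inner_hessian_I_smul_fderiv hF p u v w

/-- The Hessian turned by the complex structure is normal in the directions `u`, `v` if and only if
the cubic form vanishes on them. -/
theorem I_smul_hessian_mem_normalSpace_iff (hF : IsLegendrianImmersion F) (p : M)
    (u v : TangentSpace (𝓡 n) p) :
    Complex.I • hessian F p u v ∈ normalSpace F p ↔ ∀ w, sigma F p u v w = 0 := by
  have h : ∀ z, inner ℝ z (Complex.I • hessian F p u v)
      = -inner ℝ (hessian F p u v) (Complex.I • z) := fun z => by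
    rw [real_inner_comm, inner_I_smul_left]
  rw [mem_normalSpace_iff]
  simp only [h, neg_eq_zero, sigma_eq_inner_hessian hF]
  exact and_iff_left (inner_hessian_I_smul hF p u v)

end Chart

end Legendrian
end

/-! ### The normal frame and the differential of the Gauss map. -/

noncomputable section
namespace Legendrian

variable {n : ℕ} {M : Type*} [TopologicalSpace M] [ChartedSpace (EuclideanSpace ℝ (Fin n)) M]

/-- A linear identification of `ℝ^(n+1)` with `ℝ^n × ℝ`. -/
def splitLast (n : ℕ) :
    EuclideanSpace ℝ (Fin (n + 1)) ≃L[ℝ] EuclideanSpace ℝ (Fin n) × ℝ :=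
  ContinuousLinearEquiv.ofFinrankEq (by simp)

/-- The linear map `(v, t) ↦ J (dF v + t F)` of `ℝ^n × ℝ` onto the normal space of a Legendrian
immersion, in the preferred chart at `p`. -/
def normalFrame (F : M → AmbientSpace n) (p : M) (x : EuclideanSpace ℝ (Fin n)) :
    EuclideanSpace ℝ (Fin (n + 1)) →L[ℝ] AmbientSpace n :=
  (complexStructure n).comp
    ((fderiv ℝ (localRep F p) x).comp
        ((ContinuousLinearMap.fst ℝ _ _).comp (splitLast n).toContinuousLinearMap) +
      ((ContinuousLinearMap.snd ℝ _ _).comp (splitLast n).toContinuousLinearMap).smulRight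
        (localRep F p x))

theorem normalFrame_symm_apply (F : M → AmbientSpace n) (p : M) (x v : EuclideanSpace ℝ (Fin n))
    (t : ℝ) : normalFrame F p x ((splitLast n).symm (v, t)) =
      Complex.I • (fderiv ℝ (localRep F p) x v + t • localRep F p x) := by
  simp [normalFrame, smul_comm t]

section Frame

variable [IsManifold (𝓡 n) ∞ M] {F : M → AmbientSpace n}

theorem range_normalFrame (hF : IsLegendrianImmersion F) (p : M) {x : EuclideanSpace ℝ (Fin n)}
    (hx : x ∈ (extChartAt (𝓡 n) p).target) :
    Set.range (normalFrame F p x) = normalSpace F ((extChartAt (𝓡 n) p).symm x) := by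
  rw [hF.normalSpace_eq_map, ← range_fderiv_localRep hF.contMDiff p hx]
  ext z
  constructor
  · rintro ⟨y, rfl⟩
    obtain ⟨⟨v, t⟩, rfl⟩ := (splitLast n).symm.surjective y
    rw [normalFrame_symm_apply]
    exact ⟨_, Submodule.add_mem_sup ⟨v, rfl⟩
      (Submodule.smul_mem _ t (Submodule.mem_span_singleton_self _)), rfl⟩
  · rintro ⟨y, hy, rfl⟩
    obtain ⟨_, ⟨v, rfl⟩, _, hb, rfl⟩ := Submodule.mem_sup.1 hy
    obtain ⟨t, rfl⟩ := Submodule.mem_span_singleton.1 hb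
    exact ⟨(splitLast n).symm (v, t), normalFrame_symm_apply F p x v t⟩

theorem normalFrame_injective (hF : IsLegendrianImmersion F) (p : M)
    {x : EuclideanSpace ℝ (Fin n)} (hx : x ∈ (extChartAt (𝓡 n) p).target) :
    Function.Injective (normalFrame F p x) := by
  have h : LinearMap.range (normalFrame F p x :
      EuclideanSpace ℝ (Fin (n + 1)) →ₗ[ℝ] AmbientSpace n)
        = normalSpace F ((extChartAt (𝓡 n) p).symm x) :=
    SetLike.coe_injective (range_normalFrame hF p hx)
  have h1 := LinearMap.finrank_range_add_finrank_ker (normalFrame F p x :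
      EuclideanSpace ℝ (Fin (n + 1)) →ₗ[ℝ] AmbientSpace n)
  rw [h, hF.finrank_normalSpace, finrank_euclideanSpace_fin] at h1
  have h2 : finrank ℝ (LinearMap.ker (normalFrame F p x :
      EuclideanSpace ℝ (Fin (n + 1)) →ₗ[ℝ] AmbientSpace n)) = 0 := by omega
  exact LinearMap.ker_eq_bot.1 (Submodule.finrank_eq_zero.1 h2)

/-- The product rule for `J (dF v + t F)`. For Legendrian `F` the `t`-term stays in `N_p`, so only
the Hessian can move the plane. -/
theorem exists_hasFDerivAt_normalFrame (hF : ContMDiff (𝓡 n) 𝓘(ℝ, AmbientSpace n) ∞ F) (p : M) :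
    ∃ L' : EuclideanSpace ℝ (Fin n) →L[ℝ] EuclideanSpace ℝ (Fin (n + 1)) →L[ℝ] AmbientSpace n,
      HasFDerivAt (normalFrame F p) L' (extChartAt (𝓡 n) p p) ∧
      ∀ u v t, L' u ((splitLast n).symm (v, t)) = Complex.I • hessian F p u v +
        t • Complex.I • fderiv ℝ (localRep F p) (extChartAt (𝓡 n) p p) u := by
  have hd := hasFDerivAt_fderiv_localRep hF p
  have hG := ((contDiffAt_localRep hF p (mem_extChartAt_target p)).differentiableAt
    (by simp)).hasFDerivAt
  set x₀ := extChartAt (𝓡 n) p p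
  have h1 := hd.clm_comp (hasFDerivAt_const
    ((ContinuousLinearMap.fst ℝ _ _).comp (splitLast n).toContinuousLinearMap) x₀)
  have h2 := HasFDerivAt.comp x₀ (ContinuousLinearMap.smulRightL ℝ _ (AmbientSpace n)
    ((ContinuousLinearMap.snd ℝ _ _).comp (splitLast n).toContinuousLinearMap)).hasFDerivAt hG
  have h3 := (hasFDerivAt_const (complexStructure n) x₀).clm_comp (h1.add h2)
  refine ⟨_, h3, fun u v t => ?_⟩
  simp [smul_comm t]

/-- The derivative of the Gauss map has as kernel the radical of the cubic form. -/
theorem exists_hasMFDerivAt_gaussMap (hF : IsLegendrianImmersion F) (p : M)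
    (o : ∀ q, Orientation ℝ (normalSpace F q) (Fin (n + 1))) (ho : IsOrientationNear F o p) :
    ∃ A' : EuclideanSpace ℝ (Fin n) →L[ℝ] OrientedGrassmannian.Model (n + 1) (AmbientSpace n),
      HasMFDerivAt (𝓡 n) 𝓘(ℝ, OrientedGrassmannian.Model (n + 1) (AmbientSpace n))
        (gaussMap hF o) p A' ∧
      ∀ u : TangentSpace (𝓡 n) p, A' u = 0 ↔ ∀ v w, sigma F p v w u = 0 := by
  have hspec := (OrientedGrassmannian.exists_graph_eq (gaussMap hF o p)).choose_spec
  set Φ := (OrientedGrassmannian.exists_graph_eq (gaussMap hF o p)).choose with hΦ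
  obtain ⟨L', hL', hform⟩ := exists_hasFDerivAt_normalFrame hF.contMDiff p
  have hx₀ := mem_extChartAt_target (I := 𝓡 n) p
  have hrange₀ := range_normalFrame hF p hx₀
  rw [extChartAt_to_inv] at hrange₀
  have hrange : Set.range (normalFrame F p (extChartAt (𝓡 n) p p))
      = Set.range (OrientedGrassmannian.graphMap Φ 0) := by
    rw [hrange₀]
    exact congrArg (fun V => (V.plane : Set (AmbientSpace n))) hspec.symm
  obtain ⟨A, A', hA₀, hA, hAr, hker⟩ := OrientedGrassmannian.exists_hasFDerivAt_graphMap Φ hL'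
    (normalFrame_injective hF p hx₀) hrange
  refine ⟨A', OrientedGrassmannian.hasMFDerivAt_of_eventually_eq_graph hA ?_, fun u => ?_⟩
  · obtain ⟨U, hU, ν, hν, hb⟩ := ho
    -- `R q` sends the standard basis to the given positive frame. This merely continuous frame
    -- controls the orientation; the planes themselves are controlled by `normalFrame`.
    let R : M → EuclideanSpace ℝ (Fin (n + 1)) →L[ℝ] AmbientSpace n := fun q =>
      ∑ i, ContinuousLinearMap.smulRightL ℝ _ (AmbientSpace n) (EuclideanSpace.proj i) (ν i q)
    have hR : ContinuousAt R p := by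
      refine tendsto_finsetSum _ fun i _ => ?_
      exact (ContinuousLinearMap.continuous _).continuousAt.comp ((hν i).continuousAt hU)
    refine OrientedGrassmannian.eventually_eq_graph hR ?_ Φ
      (A := fun q => A (extChartAt (𝓡 n) p q)) ?_ ?_
    · filter_upwards [hU] with q hq
      obtain ⟨b, hbo, hbν⟩ := hb q hq
      refine OrientedGrassmannian.exists_eq_ofInjective (V := gaussMap hF o q) b hbo (R q) fun i => ?_
      refine Eq.trans ?_ (hbν i).symm
      simp [R]
    · simp only [hA₀]
      exact hspec
    · filter_upwards [(continuousAt_extChartAt (I := 𝓡 n) p).eventually hAr,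
        extChartAt_source_mem_nhds (I := 𝓡 n) p] with q hq hqs
      rw [← hq, range_normalFrame hF p ((extChartAt (𝓡 n) p).map_source hqs),
        (extChartAt (𝓡 n) p).left_inv hqs]
      rfl
  · refine (hker u).trans ?_
    rw [hrange₀]
    have hu : Complex.I • fderiv ℝ (localRep F p) (extChartAt (𝓡 n) p p) u ∈ normalSpace F p := by
      have h := hF.J_diff_mem p u
      rwa [diff_eq_fderiv hF.contMDiff] at h
    -- Total symmetry moves the direction of differentiation `u` to the first slot, where the
    -- Hessian criterion applies.
    have hσ : ∀ v w, sigma F p v w u = sigma F p u v w := fun v w => by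
      rw [sigma_swap_right hF, sigma_swap_left hF]
    simp only [hσ, ← I_smul_hessian_mem_normalSpace_iff hF]
    constructor
    · intro h v
      -- Taking `t = 0` isolates the Hessian term.
      have h' := hform u v 0
      rw [zero_smul, add_zero] at h'
      rw [← h']
      exact h _
    · intro h y
      obtain ⟨⟨v, t⟩, rfl⟩ := (splitLast n).symm.surjective y
      refine (hform u v t).symm ▸ ?_
      exact Submodule.add_mem _ (h v) (Submodule.smul_mem _ t hu)

end Frame

/-! ### Linear algebra of the fundamental matrix. -/

theorem sigma_sum_smul (F : M → AmbientSpace n) (p : M) (u v : TangentSpace (𝓡 n) p)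
    (e : Fin n → TangentSpace (𝓡 n) p) (c : Fin n → ℝ) :
    sigma F p u v (∑ i, c i • e i) = ∑ i, sigma F p u v (e i) * c i := by
  simp only [sigma, map_sum, map_smul, Finset.smul_sum, inner_sum]
  refine Finset.sum_congr rfl fun i _ => ?_
  rw [smul_comm, inner_smul_right, mul_comm]

/-- Linearity is used in the last slot only; symmetry brings each of the other two arguments there
to be expanded. -/
theorem sigma_eq_zero_of_basis [IsManifold (𝓡 n) ∞ M] {F : M → AmbientSpace n}
    (hF : IsLegendrianImmersion F) {p : M} (b : Basis (Fin n) ℝ (TangentSpace (𝓡 n) p))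
    {u : TangentSpace (𝓡 n) p} (h : ∀ i j, sigma F p (b i) (b j) u = 0)
    (v w : TangentSpace (𝓡 n) p) : sigma F p v w u = 0 := by
  have h1 : ∀ i, sigma F p (b i) w u = 0 := by
    intro i
    rw [sigma_swap_right hF, ← b.sum_repr w, sigma_sum_smul]
    refine Finset.sum_eq_zero fun j _ => ?_
    rw [sigma_swap_right hF, h, zero_mul]
  rw [sigma_swap_left hF, sigma_swap_right hF, ← b.sum_repr v, sigma_sum_smul]
  refine Finset.sum_eq_zero fun i _ => ?_
  rw [sigma_swap_right hF, sigma_swap_left hF, h1, zero_mul]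

/-- The matrix with entries `σ(e_i, e_j, e_a)`, with rows indexed by `(i, j)`. -/
def sigmaMatrix (F : M → AmbientSpace n) (p : M) (e : Fin n → TangentSpace (𝓡 n) p) :
    Matrix (Fin n × Fin n) (Fin n) ℝ :=
  Matrix.of fun ij a => sigma F p (e ij.1) (e ij.2) (e a)

theorem fundamentalMatrix_eq_transpose_mul (F : M → AmbientSpace n) (p : M)
    (e : Fin n → TangentSpace (𝓡 n) p) :
    fundamentalMatrix F p e = (sigmaMatrix F p e).transpose * sigmaMatrix F p e := by
  ext a b
  simp [fundamentalMatrix, sigmaMatrix, Matrix.mul_apply, Fintype.sum_prod_type]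

/-- For the Gram matrix `S = Tᵀ T`, positive eigenvalues are the nonzero ones, their number is the
rank of `S`, and `Tᵀ T` has the rank of `T`. -/
theorem card_pos_eigenvalues_fundamentalMatrix (F : M → AmbientSpace n) (p : M)
    (e : Fin n → TangentSpace (𝓡 n) p) :
    (Finset.univ.filter fun i : Fin n =>
      0 < (isHermitian_fundamentalMatrix F p e).eigenvalues i).card = (sigmaMatrix F p e).rank := by
  have hpsd : (fundamentalMatrix F p e).PosSemidef := by
    rw [fundamentalMatrix_eq_transpose_mul, ← Matrix.conjTranspose_eq_transpose_of_trivial]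
    exact Matrix.posSemidef_conjTranspose_mul_self _
  rw [← Matrix.rank_transpose_mul_self, ← fundamentalMatrix_eq_transpose_mul,
    (isHermitian_fundamentalMatrix F p e).rank_eq_card_non_zero_eigs, Fintype.card_subtype]
  congr 1
  ext i
  simp only [Finset.mem_filter, Finset.mem_univ, true_and]
  exact (hpsd.eigenvalues_nonneg i).lt_iff_ne'

end Legendrian

/-- Rank–nullity: two linear maps on `K^ι` with the same kernel have the same rank. Thus the
differential can be compared with `T` although their codomains differ. -/
theorem Module.Basis.finrank_range_eq_rank {ι m K V W : Type*} [Fintype ι] [Fintype m]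
    [Field K] [AddCommGroup V] [Module K V] [AddCommGroup W] [Module K W] (e : Basis ι K V)
    (f : V →ₗ[K] W) (T : Matrix m ι K)
    (h : ∀ c : ι → K, f (∑ i, c i • e i) = 0 ↔ T.mulVec c = 0) :
    finrank K (LinearMap.range f) = T.rank := by
  have hker : LinearMap.ker (f ∘ₗ e.equivFun.symm.toLinearMap) = LinearMap.ker T.mulVecLin := by
    ext c
    simpa [Basis.equivFun_symm_apply] using h c
  have h1 := LinearMap.finrank_range_add_finrank_ker (f ∘ₗ e.equivFun.symm.toLinearMap)
  have h2 := LinearMap.finrank_range_add_finrank_ker T.mulVecLin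
  rw [LinearMap.range_comp_of_range_eq_top _ (LinearEquiv.range _), hker] at h1
  rw [Matrix.rank]
  omega

end

theorem mainTheorem6 (n : ℕ) (M : Type*) [TopologicalSpace M]
    [ChartedSpace (EuclideanSpace ℝ (Fin n)) M] [IsManifold (𝓡 n) ∞ M]
    (F : M → Legendrian.AmbientSpace n) (hF : Legendrian.IsLegendrianImmersion F) (p : M)
    (e : Fin n → TangentSpace (𝓡 n) p) (he : Legendrian.IsOrthonormalFrameAt F p e)
    (k : ℕ)
    (hk : (Finset.univ.filter fun i : Fin n =>
      0 < (Legendrian.isHermitian_fundamentalMatrix F p e).eigenvalues i).card = k)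
    (o : ∀ q, Orientation ℝ (Legendrian.normalSpace F q) (Fin (n + 1)))
    (ho : Legendrian.IsOrientationNear F o p) :
    MDifferentiableAt (𝓡 n)
        𝓘(ℝ, OrientedGrassmannian.Model (n + 1) (Legendrian.AmbientSpace n))
        (Legendrian.gaussMap hF o) p ∧
      Module.finrank ℝ (LinearMap.range
        (mfderiv (𝓡 n) 𝓘(ℝ, OrientedGrassmannian.Model (n + 1) (Legendrian.AmbientSpace n))
          (Legendrian.gaussMap hF o) p).toLinearMap) = k := by
  obtain ⟨A', hA', hker⟩ := Legendrian.exists_hasMFDerivAt_gaussMap hF p o ho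
  refine ⟨hA'.mdifferentiableAt, ?_⟩
  rw [← hk, Legendrian.card_pos_eigenvalues_fundamentalMatrix, hA'.mfderiv]
  -- The images of the `e i` under `dF` are orthonormal, so the `n` vectors `e i` are independent
  -- and form a basis.
  have hli : LinearIndependent ℝ e :=
    LinearIndependent.of_comp (Legendrian.diff F p).toLinearMap he.linearIndependent
  have hcard : Fintype.card (Fin n) = finrank ℝ (TangentSpace (𝓡 n) p) := by
    change _ = finrank ℝ (EuclideanSpace ℝ (Fin n))
    simp
  have hspan : ⊤ ≤ Submodule.span ℝ (Set.range e) := by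
    have : FiniteDimensional ℝ (TangentSpace (𝓡 n) p) :=
      inferInstanceAs (FiniteDimensional ℝ (EuclideanSpace ℝ (Fin n)))
    exact (hli.span_eq_top_of_card_eq_finrank' hcard).ge
  let b := Basis.mk hli hspan
  have hb : ∀ i, b i = e i := fun i => Basis.mk_apply hli hspan i
  refine b.finrank_range_eq_rank _ _ fun c => ?_
  refine (hker _).trans ?_
  simp only [hb]
  constructor
  · intro h
    ext ij
    rw [Pi.zero_apply, ← h (e ij.1) (e ij.2), Legendrian.sigma_sum_smul]
    rfl
  · intro h
    refine Legendrian.sigma_eq_zero_of_basis hF b fun i j => ?_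
    rw [hb, hb, Legendrian.sigma_sum_smul]
    exact congrFun h (i, j)
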